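/- Let $K$ be a global field, i.e. a number field or a finitely generated extension of transcendence degree one of a finite field. Let $X$ be the associated scheme: $X=\operatorname{Spec}\mathcal{O}_K$ if $K$ is a number field, and $X$ the smooth projective curve with function field $K$ otherwise. The closed points $P$ of $X$ correspond bijectively, via $P\mapsto\mathcal{O}_{X,P}$, to the discrete valuation rings of $K$ (with fraction field $K$); let $\mathfrak{m}_P$ be the maximal ideal of $\mathcal{O}_{X,P}$. For a nonzero effective divisor $D=\sum_P \nu_P(D)\,P$ on $X$ put $$\mathcal{O}_D=\bigcap_{P\in\operatorname{Supp}D}\mathcal{O}_{X,P},\qquad I_D=\bigcap_{P\in\operatorname{Supp}D}\mathfrak{m}_P^{\nu_P(D)},\qquad \mathsf{N}_K(D)=\#(\mathcal{O}_D/I_D),\qquad \varphi_K(D)=\#(\mathcal{O}_D/I_D)^\times,$$ and put $\mathsf{N}_K(0)=\varphi_K(0)=1$. For $s\in\mathbb{C}$ with real part $\sigma$ consider $$\zeta_K(s)=\sum_{D\ge 0}\mathsf{N}_K(D)^{-s},\qquad T_K(s)=\sum_{D\ge 0}\varphi_K(D)^{-s},\qquad f_K(s)=\prod_{P}\left[1+(\mathsf{N}_K(P)-1)^{-s}-\mathsf{N}_K(P)^{-s}\right],$$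 where the sums range over all effective divisors of $X$ and the product over all closed points of $X$. Then: 1. The series $T_K(s)$ converges absolutely for $\sigma>1$, and uniformly on every half plane $\sigma\ge 1+\delta$ with $\delta>0$ (hence locally uniformly on $\sigma>1$). 2. For $\sigma>1$ the series $\zeta_K(s)$ converges absolutely, $\zeta_K(s)\ne 0$, and $T_K(s)=\zeta_K(s)\,f_K(s)$, i.e. $T_K(s)/\zeta_K(s)=f_K(s)$. 3. The product $f_K(s)$ converges absolutely (that is, $\sum_P\left|(\mathsf{N}_K(P)-1)^{-s}-\mathsf{N}_K(P)^{-s}\right|<\infty$) and locally uniformly for $\sigma>0$, and $f_K$ is holomorphic on $\sigma>0$. -/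

import Mathlib

open scoped BigOperators Topology

noncomputable section

namespace GlobalTotient

/-- A global field: either a number field, or a global function field, i.e. a finitely generated
extension of transcendence degree one of some finite field `F`, which means that `K` is a finite
extension of a rational function field `F(t)`. -/
def IsGlobalField (K : Type*) [Field K] : Prop :=
  NumberField K ∨
    ∃ F : Subfield K, Finite F ∧
      ∃ t : K, Transcendental F t ∧ FiniteDimensional (IntermediateField.adjoin F {t}) K

/-- The closed points `P` of the scheme `X` associated to the global field `K`, each given by its
local ring `𝒪_{X,P}` as a subring of the function field `K` of `X`. These local rings are exactly
the discrete valuation rings of `K`: for a number field, the localizations of the ring of integers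
at its maximal ideals (see `isDiscreteValuationRing_iff_of_numberField`); for a function field, the
discrete valuation rings of `K` over the constants, which are the points of its smooth projective
model (the constants lie in every valuation ring, see `subfield_le_valuationSubring`). -/
def ClosedPoint (K : Type*) [Field K] : Type _ :=
  {A : ValuationSubring K // IsDiscreteValuationRing A}

/-- The effective Weil divisors of `X`: finite formal sums of closed points with coefficients
in `ℕ`. -/
abbrev EffDivisor (K : Type*) [Field K] : Type _ := ClosedPoint K →₀ ℕ

variable {K : Type*} [Field K]

/-- A finite subfield is contained in every valuation ring of `K`. -/
theorem subfield_le_valuationSubring (F : Subfield K) [Finite F] (A : ValuationSubring K) :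
    F.toSubring ≤ A.toSubring := by
  intro x hx
  by_cases h0 : x = 0
  · simp [h0]
  obtain ⟨n, hn, h1⟩ := isOfFinOrder_iff_pow_eq_one.mp
    (isOfFinOrder_of_finite (Units.mk0 (⟨x, hx⟩ : F) (by simpa [Subtype.ext_iff] using h0)))
  have h2 : x ^ n = 1 := by
    have := congrArg (fun u : Fˣ => ((u : F) : K)) h1
    simpa using this
  rcases A.mem_or_inv_mem x with h | h
  · exact h
  · have h3 : x = x⁻¹ ^ (n - 1) := by
      rw [inv_pow]
      refine (eq_inv_of_mul_eq_one_left ?_)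
      rw [← pow_succ', Nat.sub_add_cancel hn, h2]
    rw [h3]
    exact A.toSubring.pow_mem h _

open IsDedekindDomain in
/-- For a number field, the discrete valuation rings of `K` are exactly the localizations of its
ring of integers at the nonzero prime ideals, i.e. the local rings at the closed points of
`Spec 𝒪_K`. -/
theorem isDiscreteValuationRing_iff_of_numberField [NumberField K] (A : ValuationSubring K) :
    IsDiscreteValuationRing A ↔
      ∃ v : HeightOneSpectrum (NumberField.RingOfIntegers K),
        A = HeightOneSpectrum.valuationSubringAtPrime K v := by
  constructor
  · intro hA
    have hint : ∀ x : NumberField.RingOfIntegers K, (x : K) ∈ A := by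
      intro x
      have hx : IsIntegral A (x : K) := (NumberField.RingOfIntegers.isIntegral_coe x).tower_top
      obtain ⟨y, hy⟩ := IsIntegrallyClosed.isIntegral_iff.mp hx
      rw [← hy]; exact y.2
    let f : NumberField.RingOfIntegers K →+* A :=
      (algebraMap (NumberField.RingOfIntegers K) K).codRestrict A.toSubring hint
    let p := (IsLocalRing.maximalIdeal A).comap f
    have hp : p.IsPrime := Ideal.comap_isPrime _ _
    have hunit : ∀ x : NumberField.RingOfIntegers K, x ∉ p → (x : K)⁻¹ ∈ A := by
      intro x hx
      have hu : IsUnit (f x) := by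
        by_contra h
        exact hx ((IsLocalRing.mem_maximalIdeal _).mpr h)
      obtain ⟨u, hu⟩ := hu
      have h1 : ((u : A) : K) = x := congrArg Subtype.val hu
      have h2 : ((u : A) : K) * ((u⁻¹ : Aˣ) : A) = 1 := by
        exact congrArg (Subtype.val : A → K) u.mul_inv
      rw [← h1, inv_eq_of_mul_eq_one_right h2]
      exact ((u⁻¹ : Aˣ) : A).2
    have hne : p ≠ ⊥ := by
      intro hb
      apply IsDiscreteValuationRing.not_isField A
      have htop : ∀ z : K, z ∈ A := by
        intro z
        obtain ⟨a, b, hb0, rfl⟩ := IsFractionRing.div_surjective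
          (A := NumberField.RingOfIntegers K) z
        rw [div_eq_mul_inv]
        refine A.mul_mem _ _ (hint a) (hunit b ?_)
        rw [hb]
        simpa using nonZeroDivisors.ne_zero hb0
      refine ⟨⟨0, 1, zero_ne_one⟩, mul_comm, fun {a} ha => ⟨⟨(a : K)⁻¹, htop _⟩, ?_⟩⟩
      apply Subtype.ext
      have : (a : K) ≠ 0 := fun h => ha (Subtype.ext h)
      simpa using mul_inv_cancel₀ this
    refine ⟨⟨p, hp, hne⟩, (ValuationSubring.eq_of_le_of_ne_top _ ?_ ?_).symm⟩
    · intro z hz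
      obtain ⟨a, s, hs, rfl⟩ := hz
      exact A.mul_mem _ _ (hint a) (hunit s hs)
    · rintro rfl
      apply IsDiscreteValuationRing.not_isField (⊤ : ValuationSubring K)
      refine ⟨⟨0, 1, zero_ne_one⟩, mul_comm, fun {a} ha => ⟨⟨(a : K)⁻¹, trivial⟩, ?_⟩⟩
      apply Subtype.ext
      have : (a : K) ≠ 0 := fun h => ha (Subtype.ext h)
      simpa using mul_inv_cancel₀ this
  · rintro ⟨v, rfl⟩
    rw [HeightOneSpectrum.valuationSubringAtPrime_eq_valuationSubring]
    exact (v.valuation K).valuationSubring_isDiscreteValuationRing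

/-- The ring `𝒪_D = ⋂_{P ∈ Supp D} 𝒪_{X,P}`. -/
def divisorRing (D : EffDivisor K) : Subring K :=
  ⨅ P : D.support, P.1.1.toSubring

/-- The inclusion of `𝒪_D` into `𝒪_{X,P}`, for `P` in the support of `D`. -/
def toLocalRing (D : EffDivisor K) (P : D.support) : divisorRing D →+* P.1.1 :=
  Subring.inclusion (iInf_le (fun Q : D.support => Q.1.1.toSubring) P)

/-- The ideal `I_D = ⋂_{P ∈ Supp D} 𝔪_P ^ {ν_P(D)}` of `𝒪_D`. -/
def divisorIdeal (D : EffDivisor K) : Ideal (divisorRing D) :=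
  ⨅ P : D.support, ((IsLocalRing.maximalIdeal P.1.1) ^ (D P.1)).comap (toLocalRing D P)

open Classical in
/-- The norm `N_K(D)`: it is `1` for `D = 0`, and `#(𝒪_D / I_D)` otherwise. -/
def norm (D : EffDivisor K) : ℕ :=
  if D = 0 then 1 else Nat.card (divisorRing D ⧸ divisorIdeal D)

open Classical in
/-- The Euler function `φ_K(D)`: it is `1` for `D = 0`, and `#(𝒪_D / I_D)ˣ` otherwise. -/
def euler (D : EffDivisor K) : ℕ :=
  if D = 0 then 1 else Nat.card (divisorRing D ⧸ divisorIdeal D)ˣ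

/-- The norm of a closed point, i.e. of the corresponding prime divisor. -/
def pointNorm (P : ClosedPoint K) : ℕ := norm (Finsupp.single P 1)

variable (K)

/-- The Weil zeta function `ζ_K(s) = ∑_{D ≥ 0} N_K(D)^{-s}` (for `Re s > 1`). -/
def weilZeta (s : ℂ) : ℂ := ∑' D : EffDivisor K, (norm D : ℂ) ^ (-s)

/-- The totient zeta function `T_K(s) = ∑_{D ≥ 0} φ_K(D)^{-s}`. -/
def totientZeta (s : ℂ) : ℂ := ∑' D : EffDivisor K, (euler D : ℂ) ^ (-s)

variable {K}

/-- The factor `1 + (N P - 1)^{-s} - (N P)^{-s}`. -/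
def eulerFactor (P : ClosedPoint K) (s : ℂ) : ℂ :=
  1 + ((pointNorm P : ℂ) - 1) ^ (-s) - (pointNorm P : ℂ) ^ (-s)

variable (K)

/-- The product `f_K(s) = ∏_P [1 + (N P - 1)^{-s} - (N P)^{-s}]` over all closed points. -/
def eulerProd (s : ℂ) : ℂ := ∏' P : ClosedPoint K, eulerFactor P s

end GlobalTotient

end

/-!
Weak approximation for the pairwise inequivalent absolute values of the closed points yields
`𝒪_D / I_D ≃ ∏ 𝒪_P / 𝔪_P ^ ν_P(D)`, so `N_K` and `φ_K` are multiplicative in `D`. Both series are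
thus Euler products over the closed points, with local factors `(1 - N(P)^{-s})⁻¹` and
`(1 - N(P)^{-s})⁻¹ (1 + (N(P) - 1)^{-s} - N(P)^{-s})`, and dividing them leaves `f_K`.

Everything converges because `∑ N(P)^{-σ} < ∞` for `σ > 1`. To see this, let `R` be `ℤ` or `F[u]`
and let `K` have degree at most `n` over its fraction field. Weak approximation makes the
intersection of the valuation rings of finitely many points over one prime `p` of `R` surject onto
the product of their residue fields, which therefore has rank at most `n` over `R / p`; so `p` has
at most `n` points above it, each of norm at least `#(R / p)`, and the sum reduces to one over the
primes of `R`. For a function field, every point lies over `F[t]` or over `F[t⁻¹]`.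

By the mean value theorem `(N - 1)^{-s} - N^{-s} = O(|s| (N - 1)^{-σ - 1})`, which gains a full
power and carries `f_K` to the half plane `σ > 0`.
-/

noncomputable section

namespace GlobalTotient

open IsLocalRing

section DiscreteValuationRing

variable {A : Type*} [CommRing A] [IsDomain A] [IsDiscreteValuationRing A]
  {L : Type*} [Field L] [Algebra A L] [IsFractionRing A L] {b : NNReal}

open IsDiscreteValuationRing in
theorem adicAbv_le_one_iff_mem_range (hb : 1 < b) {x : L} :
    (IsDiscreteValuationRing.maximalIdeal A).adicAbv hb x ≤ 1 ↔ x ∈ Set.range (algebraMap A L) := by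
  refine ⟨fun h => exists_lift_of_le_one ?_, ?_⟩
  · exact (WithZeroMulInt.toNNReal_le_one_iff hb).mp h
  · rintro ⟨a, rfl⟩
    exact (IsDiscreteValuationRing.maximalIdeal A).adicAbv_coe_le_one hb a

theorem adicAbv_lt_one_of_irreducible (hb : 1 < b) {ϖ : A} (hϖ : Irreducible ϖ) :
    (IsDiscreteValuationRing.maximalIdeal A).adicAbv hb (algebraMap A L ϖ) < 1 :=
  ((IsDiscreteValuationRing.maximalIdeal A).adicAbv_coe_lt_one_iff hb ϖ).mpr
    ((mem_maximalIdeal ϖ).mpr hϖ.not_isUnit)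

theorem exists_pos_forall_adicAbv_le_imp_mem_pow (hb : 1 < b) (k : ℕ) :
    ∃ ε > 0, ∀ x : L, (IsDiscreteValuationRing.maximalIdeal A).adicAbv hb x ≤ ε →
      ∃ a ∈ maximalIdeal A ^ k, algebraMap A L a = x := by
  obtain ⟨ϖ, hϖ⟩ := IsDiscreteValuationRing.exists_irreducible A
  have hϖ0 : algebraMap A L ϖ ^ k ≠ 0 :=
    pow_ne_zero k (FaithfulSMul.algebraMap_eq_zero_iff A L |>.not.mpr hϖ.ne_zero)
  have hpos := ((IsDiscreteValuationRing.maximalIdeal A).adicAbv hb).pos hϖ0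
  refine ⟨_, hpos, fun x hx => ?_⟩
  obtain ⟨a, ha⟩ : x / algebraMap A L ϖ ^ k ∈ Set.range (algebraMap A L) := by
    rw [← adicAbv_le_one_iff_mem_range hb, map_div₀]
    exact (div_le_one hpos).mpr hx
  refine ⟨a * ϖ ^ k, Ideal.mul_mem_left _ a (Ideal.pow_mem_pow ?_ k), ?_⟩
  · exact (mem_maximalIdeal ϖ).mpr hϖ.not_isUnit
  · rw [map_mul, map_pow, ha, div_mul_cancel₀ _ hϖ0]

end DiscreteValuationRing

theorem card_units_mul_card_of_surjective {A k : Type*} [CommRing A] [Finite A] [Field k]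
    {f : A →+* k} [IsLocalHom f] (hf : Function.Surjective f) :
    Nat.card Aˣ * Nat.card k = Nat.card A * (Nat.card k - 1) := by
  have hker : Nat.card A = Nat.card k * Nat.card (RingHom.ker f) := by
    rw [← Nat.card_congr (RingHom.quotientKerEquivOfSurjective hf).toEquiv]
    exact (RingHom.ker f).toAddSubgroup.card_eq_card_quotient_mul_card_addSubgroup
  have hunits : Nat.card Aˣ = Nat.card {x // ¬ x ∈ RingHom.ker f} := by
    refine Nat.card_congr ((Equiv.ofInjective _ Units.val_injective).trans
      (Equiv.subtypeEquivRight fun x => ?_))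
    rw [RingHom.mem_ker, ← ne_eq, ← isUnit_iff_ne_zero, isUnit_map_iff]
    rfl
  have hsum : Nat.card (RingHom.ker f) + Nat.card Aˣ = Nat.card A := by
    classical
    rw [hunits, ← Nat.card_congr (Equiv.sumCompl (· ∈ RingHom.ker f)), Nat.card_sum]
  rw [Nat.mul_sub_one, ← hsum, add_mul, hsum, hker, mul_comm (Nat.card k), Nat.add_sub_cancel_left]

instance isLocalHom_factor_maximalIdeal_pow (A : Type*) [CommRing A] [IsLocalRing A] (k : ℕ) :
    IsLocalHom (Ideal.Quotient.factor
      (Ideal.pow_le_self (I := maximalIdeal A) k.succ_ne_zero)) where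
  map_nonunit x hx := by
    obtain ⟨a, rfl⟩ := Ideal.Quotient.mk_surjective x
    rw [Ideal.Quotient.factor_mk] at hx
    exact ((isUnit_map_iff (residue A) a).mp hx).map _

section Residue

variable (A : Type*) [CommRing A] [IsDomain A] [IsDiscreteValuationRing A]

theorem card_quotient_maximalIdeal_pow (k : ℕ) :
    Nat.card (A ⧸ maximalIdeal A ^ k) = Nat.card (ResidueField A) ^ k :=
  cardQuot_pow_of_prime (IsDiscreteValuationRing.not_a_field A)

theorem card_units_quotient_maximalIdeal_pow_succ [Finite (ResidueField A)] (k : ℕ) :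
    Nat.card (A ⧸ maximalIdeal A ^ (k + 1))ˣ =
      Nat.card (ResidueField A) ^ k * (Nat.card (ResidueField A) - 1) := by
  have hq : 0 < Nat.card (ResidueField A) := Nat.card_pos
  have hcard := card_quotient_maximalIdeal_pow A (k + 1)
  have : Finite (A ⧸ maximalIdeal A ^ (k + 1)) :=
    Nat.finite_of_card_ne_zero (hcard ▸ (pow_pos hq _).ne')
  let f : A ⧸ maximalIdeal A ^ (k + 1) →+* ResidueField A :=
    Ideal.Quotient.factor (Ideal.pow_le_self k.succ_ne_zero)
  have : IsLocalHom f := isLocalHom_factor_maximalIdeal_pow A k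
  have hf : Function.Surjective f := Ideal.Quotient.factor_surjective _
  refine Nat.eq_of_mul_eq_mul_right hq ?_
  rw [card_units_mul_card_of_surjective hf, hcard]
  ring

end Residue

variable {K : Type*} [Field K]

instance (P : ClosedPoint K) : IsDiscreteValuationRing P.1 := P.2

/-- The absolute value of `K` attached to a closed point, normalized by `|ϖ| = 1 / 2` for a
uniformizer `ϖ`. It gives access to weak approximation. -/
def pointAbv (P : ClosedPoint K) : AbsoluteValue K ℝ :=
  (IsDiscreteValuationRing.maximalIdeal P.1).adicAbv (K := K) (one_lt_two : (1 : NNReal) < 2)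

theorem pointAbv_le_one_iff {P : ClosedPoint K} {x : K} : pointAbv P x ≤ 1 ↔ x ∈ P.1 :=
  (adicAbv_le_one_iff_mem_range _).trans
    ⟨fun ⟨a, ha⟩ => ha ▸ a.2, fun h => ⟨⟨x, h⟩, rfl⟩⟩

theorem pointAbv_isNontrivial (P : ClosedPoint K) : (pointAbv P).IsNontrivial := by
  obtain ⟨ϖ, hϖ⟩ := IsDiscreteValuationRing.exists_irreducible P.1
  exact ⟨ϖ, fun h => hϖ.ne_zero (Subtype.ext h), (adicAbv_lt_one_of_irreducible _ hϖ).ne⟩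

theorem not_isEquiv_pointAbv {P Q : ClosedPoint K} (h : P ≠ Q) :
    ¬ (pointAbv P).IsEquiv (pointAbv Q) := fun he =>
  h <| Subtype.ext <| SetLike.ext fun x => by
    rw [← pointAbv_le_one_iff, ← pointAbv_le_one_iff, he.le_one_iff]

theorem exists_forall_quotient_mk_eq {ι : Type*} [Finite ι] {P : ι → ClosedPoint K}
    (hP : Function.Injective P) {k : ι → ℕ} (y : ∀ i, (P i).1 ⧸ maximalIdeal (P i).1 ^ k i) :
    ∃ x : K, ∀ i, ∃ hx : x ∈ (P i).1, Ideal.Quotient.mk _ ⟨x, hx⟩ = y i := by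
  have := Fintype.ofFinite ι
  choose a ha using fun i => Ideal.Quotient.mk_surjective (y i)
  choose ε hε hmem using fun i => exists_pos_forall_adicAbv_le_imp_mem_pow
    (A := (P i).1) (L := K) (one_lt_two : (1 : NNReal) < 2) (k i)
  let z : ∀ i, WithAbs (pointAbv (P i)) := fun i => WithAbs.toAbs _ (a i : K)
  have hdense := AbsoluteValue.denseRange_algebraMap_pi (v := fun i => pointAbv (P i))
    (fun i => pointAbv_isNontrivial _) (fun i j hij => not_isEquiv_pointAbv (hP.ne hij))
  obtain ⟨x, hx⟩ := hdense.exists_mem_open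
    (isOpen_set_pi Set.finite_univ fun i _ => Metric.isOpen_ball (x := z i) (ε := ε i))
    ⟨z, fun i _ => Metric.mem_ball_self (hε i)⟩
  refine ⟨x, fun i => ?_⟩
  have hball : dist (WithAbs.toAbs (pointAbv (P i)) x) (z i) < ε i := hx i trivial
  rw [dist_eq_norm] at hball
  obtain ⟨c, hc, hcx⟩ : ∃ c ∈ maximalIdeal (P i).1 ^ k i, (c : K) = x - a i :=
    hmem i _ hball.le
  have hxc : x = ((a i + c : (P i).1) : K) := by
    rw [Subring.coe_add, hcx, add_sub_cancel]
  refine ⟨hxc ▸ Subtype.property _, ?_⟩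
  rw [← ha i, Ideal.Quotient.eq]
  convert hc
  exact Subtype.ext hcx.symm

theorem exists_forall_residue_eq {ι : Type*} [Finite ι] {P : ι → ClosedPoint K}
    (hP : Function.Injective P) (y : ∀ i, ResidueField (P i).1) :
    ∃ x : K, ∀ i, ∃ hx : x ∈ (P i).1, residue (P i).1 ⟨x, hx⟩ = y i := by
  choose a ha using fun i => residue_surjective (y i)
  obtain ⟨x, hx⟩ := exists_forall_quotient_mk_eq hP (k := fun _ => 1)
    (fun i => Ideal.Quotient.mk _ (a i))
  refine ⟨x, fun i => (hx i).imp fun hmem heq => ha i ▸ Ideal.Quotient.eq.mpr ?_⟩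
  rw [← pow_one (maximalIdeal (P i).1)]
  exact Ideal.Quotient.eq.mp heq

/-- The Chinese remainder isomorphism `𝒪_D / I_D ≃ ∏_P 𝒪_{X,P} / 𝔪_P ^ {ν_P(D)}`. -/
def divisorQuotientEquiv (D : EffDivisor K) : (divisorRing D ⧸ divisorIdeal D) ≃+*
    ((P : D.support) → P.1.1 ⧸ maximalIdeal P.1.1 ^ D P.1) :=
  let f : divisorRing D →+* ((P : D.support) → P.1.1 ⧸ maximalIdeal P.1.1 ^ D P.1) :=
    RingHom.pi fun P => (Ideal.Quotient.mk _).comp (toLocalRing D P)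
  have hker : divisorIdeal D = RingHom.ker f := by
    ext x
    simp only [RingHom.mem_ker, divisorIdeal, Ideal.mem_iInf, Ideal.mem_comap, funext_iff]
    exact forall_congr' fun P => Ideal.Quotient.eq_zero_iff_mem.symm
  have hf : Function.Surjective f := fun y => by
    obtain ⟨x, hx⟩ := exists_forall_quotient_mk_eq (P := fun P : D.support => P.1)
      Subtype.val_injective y
    choose hmem heq using hx
    exact ⟨⟨x, Subring.mem_iInf.mpr hmem⟩, funext heq⟩
  (Ideal.quotEquivOfEq hker).trans (RingHom.quotientKerEquivOfSurjective hf)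

theorem norm_eq_prod_card_residueField (D : EffDivisor K) :
    norm D = D.prod fun P k => Nat.card (ResidueField P.1) ^ k := by
  by_cases hD : D = 0
  · simp [hD, norm]
  rw [norm, if_neg hD, Nat.card_congr (divisorQuotientEquiv D).toEquiv, Nat.card_pi, Finsupp.prod,
    ← Finset.prod_coe_sort D.support]
  exact Finset.prod_congr rfl fun P _ => card_quotient_maximalIdeal_pow _ _

theorem pointNorm_eq_card_residueField (P : ClosedPoint K) :
    pointNorm P = Nat.card (ResidueField P.1) := by
  simp [pointNorm, norm_eq_prod_card_residueField]

theorem norm_eq_prod_pointNorm (D : EffDivisor K) :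
    norm D = D.prod fun P k => pointNorm P ^ k := by
  simp only [norm_eq_prod_card_residueField D, pointNorm_eq_card_residueField]

theorem euler_eq_prod_pointNorm (hfin : ∀ P : ClosedPoint K, Finite (ResidueField P.1))
    (D : EffDivisor K) :
    euler D = D.prod fun P k => pointNorm P ^ (k - 1) * (pointNorm P - 1) := by
  by_cases hD : D = 0
  · simp [hD, euler]
  rw [euler, if_neg hD, Nat.card_congr
    ((Units.mapEquiv (divisorQuotientEquiv D).toMulEquiv).trans MulEquiv.piUnits).toEquiv,
    Nat.card_pi, Finsupp.prod, ← Finset.prod_coe_sort D.support]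
  refine Finset.prod_congr rfl fun P _ => ?_
  obtain ⟨k, hk⟩ := Nat.exists_eq_succ_of_ne_zero (Finsupp.mem_support_iff.mp P.2)
  rw [hk, pointNorm_eq_card_residueField]
  exact card_units_quotient_maximalIdeal_pow_succ P.1.1 k

theorem rank_le_of_surjective {R S N V : Type*} [CommRing R] [IsDomain R] [IsPrincipalIdealRing R]
    [AddCommGroup N] [Module R N] [Module.IsTorsionFree R N] [CommRing S] [Nontrivial S]
    [Algebra R S] [AddCommGroup V] [Module R V] [Module S V] [IsScalarTower R S V]
    {f : N →ₗ[R] V} (hf : Function.Surjective f) {n : ℕ} (hn : Module.rank R N ≤ n) :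
    Module.rank S V ≤ n := by
  classical
  refine rank_le fun s hs => ?_
  choose lift hlift using hf
  let M := Submodule.span R (Set.range fun v : s => lift v)
  have : Module.Finite R M := Module.Finite.span_of_finite R (Set.finite_range _)
  let c := Module.finBasis R M
  have hspan (v : s) : (v : V) ∈ Submodule.span S (Set.range fun i => f (c i)) := by
    let w : M := ⟨lift v, Submodule.subset_span ⟨v, rfl⟩⟩
    have hw : (v : V) = ∑ i, c.repr w i • f (c i) := by
      rw [← hlift v]
      calc f (lift v) = (f ∘ₗ M.subtype) (∑ i, c.repr w i • c i) := by rw [c.sum_repr w]; rfl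
        _ = ∑ i, c.repr w i • f (c i) := by rw [map_sum]; simp only [map_smul]; rfl
    rw [hw]
    exact Submodule.sum_mem _ fun i _ =>
      Submodule.smul_of_tower_mem _ _ (Submodule.subset_span ⟨i, rfl⟩)
  have hM : Module.finrank R M ≤ n :=
    Module.finrank_le_of_rank_le ((Submodule.rank_le M).trans hn)
  calc s.card = Fintype.card s := (Fintype.card_coe s).symm
    _ ≤ Fintype.card (Set.range fun i => f (c i)) :=
      linearIndependent_le_span_aux' _ hs _ (Set.range_subset_iff.mpr hspan)
    _ ≤ Fintype.card (Fin (Module.finrank R M)) := Fintype.card_range_le _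
    _ ≤ n := by rwa [Fintype.card_fin]

theorem natCard_le_rank_pi (F : Type*) [Field F] {ι : Type*} [Finite ι] (V : ι → Type*)
    [∀ i, AddCommGroup (V i)] [∀ i, Module F (V i)] [∀ i, Nontrivial (V i)] :
    (Nat.card ι : Cardinal) ≤ Module.rank F (∀ i, V i) := by
  classical
  choose v hv using fun i => exists_ne (0 : V i)
  have hsingle : LinearIndependent F fun i => Pi.single i (v i) :=
    (linearIndependent_equiv (Equiv.sigmaPUnit ι)).mp <|
      Pi.linearIndependent_single (fun i (_ : Unit) => v i) fun i =>
        linearIndependent_unique_iff.mpr (hv i)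
  have := Fintype.ofFinite ι
  simpa [-rank_pi] using hsingle.cardinal_lift_le_rank

theorem summable_of_card_fiber_le {ι κ : Type*} (f : ι → κ) {c : κ → ℕ} {h : κ → ℝ} {g : ι → ℝ}
    (hc : ∀ (k) (s : Finset ι), (∀ i ∈ s, f i = k) → s.card ≤ c k)
    (hg : ∀ i, 0 ≤ g i) (hh : ∀ k, 0 ≤ h k) (hgh : ∀ i, g i ≤ h (f i))
    (hs : Summable fun k => c k * h k) : Summable g := by
  classical
  refine summable_of_sum_le hg (c := ∑' k, c k * h k) fun s => ?_
  have hfiber (k : κ) : ∑ i ∈ s with f i = k, g i ≤ c k * h k :=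
    calc ∑ i ∈ s with f i = k, g i
        ≤ (s.filter (f · = k)).card • h k :=
          Finset.sum_le_card_nsmul _ _ _ fun i hi => (Finset.mem_filter.mp hi).2 ▸ hgh i
      _ = (s.filter (f · = k)).card * h k := nsmul_eq_mul _ _
      _ ≤ c k * h k := by
          gcongr
          · exact hh k
          · exact hc k _ fun i hi => (Finset.mem_filter.mp hi).2
  calc ∑ i ∈ s, g i = ∑ k ∈ s.image f, ∑ i ∈ s with f i = k, g i :=
        (Finset.sum_fiberwise_of_maps_to (fun i hi => Finset.mem_image_of_mem f hi) g).symm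
    _ ≤ ∑ k ∈ s.image f, c k * h k := Finset.sum_le_sum fun k _ => hfiber k
    _ ≤ ∑' k, c k * h k := hs.sum_le_tsum _ fun k _ => mul_nonneg (Nat.cast_nonneg _) (hh k)

/-- The closed points of `X` lying over `Spec R`, i.e. those whose local ring contains the image
of `R`. -/
def PointOver (R K : Type*) [CommRing R] [Field K] [Algebra R K] : Type _ :=
  {P : ClosedPoint K // ∀ r : R, algebraMap R K r ∈ P.1}

namespace PointOver

open IsDedekindDomain

variable {R : Type*} [CommRing R] [Algebra R K]

instance (P : PointOver R K) : Algebra R P.1.1 :=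
  ((algebraMap R K).codRestrict P.1.1.toSubring P.2).toAlgebra

instance (P : PointOver R K) : IsScalarTower R P.1.1 K :=
  IsScalarTower.of_algebraMap_eq fun _ => rfl

/-- The center of `P` on `Spec R`, i.e. the point of `Spec R` below `P`. -/
def center [Algebra.IsAlgebraic R K] (P : PointOver R K) :
    HeightOneSpectrum R where
  asIdeal := (maximalIdeal P.1.1).under R
  isPrime := inferInstance
  ne_bot := by
    obtain ⟨ϖ, hϖ⟩ := IsDiscreteValuationRing.exists_irreducible P.1.1
    refine Ideal.comap_ne_bot_of_algebraic_mem hϖ.ne_zero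
      ((mem_maximalIdeal ϖ).mpr hϖ.not_isUnit) ?_
    exact (isAlgebraic_algebraMap_iff (FaithfulSMul.algebraMap_injective P.1.1 K)).mp
      (Algebra.IsAlgebraic.isAlgebraic (algebraMap P.1.1 K ϖ))

theorem rank_pi_quotient_maximalIdeal_le [IsDomain R] [IsPrincipalIdealRing R] [FaithfulSMul R K]
    {ι : Type*} [Finite ι] {P : ι → PointOver R K}
    (hP : Function.Injective P) (p : Ideal R) [p.IsPrime]
    [∀ i, (maximalIdeal (P i).1.1).LiesOver p] {n : ℕ} (hn : Module.rank R K ≤ n) :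
    Module.rank (R ⧸ p) (∀ i, (P i).1.1 ⧸ maximalIdeal (P i).1.1) ≤ n := by
  let M : Subalgebra R K := ⨅ i, (IsScalarTower.toAlgHom R (P i).1.1 K).range
  have hM : ∀ x, x ∈ M ↔ ∀ i, x ∈ (P i).1.1 := fun x => by
    simp [M, Algebra.mem_iInf]
  let f : M →ₐ[R] (∀ i, (P i).1.1 ⧸ maximalIdeal (P i).1.1) :=
    { toFun x i := Ideal.Quotient.mk _ ⟨x, (hM _).mp x.2 i⟩
      map_one' := rfl
      map_mul' _ _ := rfl
      map_zero' := rfl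
      map_add' _ _ := rfl
      commutes' _ := rfl }
  have hf : Function.Surjective f.toLinearMap := fun y => by
    obtain ⟨x, hx⟩ := exists_forall_residue_eq (P := fun i => (P i).1)
      (fun i j hij => hP (Subtype.ext hij)) y
    choose hmem heq using hx
    exact ⟨⟨x, (hM x).mpr hmem⟩, funext heq⟩
  exact rank_le_of_surjective hf ((Submodule.rank_le M.toSubmodule).trans hn)

section FiniteRank

open Cardinal

variable [IsDomain R] [IsPrincipalIdealRing R] [FaithfulSMul R K] [Algebra.IsAlgebraic R K]

instance (P : PointOver R K) : (maximalIdeal P.1.1).LiesOver P.center.asIdeal :=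
  ⟨rfl⟩

theorem finite_residueField [Ring.HasFiniteQuotients R] (hrank : Module.rank R K < ℵ₀)
    (P : PointOver R K) : Finite (ResidueField P.1.1) := by
  obtain ⟨n, hn⟩ := lt_aleph0.mp hrank
  let _ : Field (R ⧸ P.center.asIdeal) := Ideal.Quotient.field _
  have : Finite (R ⧸ P.center.asIdeal) := Ring.HasFiniteQuotients.finiteQuotient P.center.ne_bot
  have hle := rank_pi_quotient_maximalIdeal_le (P := fun _ : Unit => P)
    (Function.injective_of_subsingleton _) P.center.asIdeal hn.le
  have : Module.Finite (R ⧸ P.center.asIdeal) (Unit → P.1.1 ⧸ maximalIdeal P.1.1) :=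
    Module.rank_lt_aleph0_iff.mp (hle.trans_lt (natCast_lt_aleph0))
  have : Finite (Unit → P.1.1 ⧸ maximalIdeal P.1.1) :=
    Module.finite_of_finite (R ⧸ P.center.asIdeal)
  exact Finite.of_surjective (fun y : Unit → P.1.1 ⧸ maximalIdeal P.1.1 => y ())
    fun x => ⟨fun _ => x, rfl⟩

theorem card_le_of_center_eq {n : ℕ} (hn : Module.rank R K ≤ n) {v : HeightOneSpectrum R}
    {s : Finset (PointOver R K)} (hs : ∀ P ∈ s, P.center = v) : s.card ≤ n := by
  let _ : Field (R ⧸ v.asIdeal) := Ideal.Quotient.field _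
  have (P : s) : (maximalIdeal P.1.1.1).LiesOver v.asIdeal := hs P P.2 ▸ inferInstance
  have hle := rank_pi_quotient_maximalIdeal_le (P := fun P : s => P.1)
    Subtype.val_injective v.asIdeal hn
  have := natCard_le_rank_pi (R ⧸ v.asIdeal)
    fun P : s => P.1.1.1 ⧸ maximalIdeal P.1.1.1
  rw [Nat.card_eq_finsetCard] at this
  exact_mod_cast this.trans hle

theorem card_quotient_center_le [Ring.HasFiniteQuotients R] (hrank : Module.rank R K < ℵ₀)
    (P : PointOver R K) : Nat.card (R ⧸ P.center.asIdeal) ≤ pointNorm P.1 := by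
  have := finite_residueField hrank P
  rw [pointNorm_eq_card_residueField]
  exact Nat.card_le_card_of_injective
    (Ideal.quotientMap (maximalIdeal P.1.1) (algebraMap R P.1.1) le_rfl)
    Ideal.quotientMap_injective

theorem summable_pointNorm_rpow [Ring.HasFiniteQuotients R] (hrank : Module.rank R K < ℵ₀)
    {σ : ℝ} (hσ : 0 ≤ σ)
    (hs : Summable fun v : HeightOneSpectrum R => (Nat.card (R ⧸ v.asIdeal) : ℝ) ^ (-σ)) :
    Summable fun P : PointOver R K => (pointNorm P.1 : ℝ) ^ (-σ) := by
  obtain ⟨n, hn⟩ := lt_aleph0.mp hrank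
  refine summable_of_card_fiber_le center (c := fun _ => n)
    (fun v s hs => card_le_of_center_eq hn.le hs) (fun _ => by positivity) (fun _ => by positivity)
    (fun P => ?_) (hs.mul_left _)
  have : Finite (R ⧸ P.center.asIdeal) := Ring.HasFiniteQuotients.finiteQuotient P.center.ne_bot
  exact Real.rpow_le_rpow_of_nonpos (mod_cast Nat.card_pos)
    (mod_cast card_quotient_center_le hrank P) (neg_nonpos.mpr hσ)

end FiniteRank

end PointOver

section Bases

open IsDedekindDomain Polynomial

theorem summable_card_quotient_int {σ : ℝ} (hσ : 1 < σ) :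
    Summable fun v : HeightOneSpectrum ℤ => (Nat.card (ℤ ⧸ v.asIdeal) : ℝ) ^ (-σ) := by
  have hinj : Function.Injective fun v : HeightOneSpectrum ℤ => Nat.card (ℤ ⧸ v.asIdeal) :=
    fun v w h => by
      ext1
      rw [← Int.ideal_span_absNorm_eq_self v.asIdeal, ← Int.ideal_span_absNorm_eq_self w.asIdeal]
      exact congrArg (fun n : ℕ => Ideal.span {(n : ℤ)}) h
  exact (Real.summable_nat_rpow.mpr (neg_lt_neg hσ)).comp_injective hinj

variable {F : Type*} [Field F]

instance hasFiniteQuotients_polynomial [Finite F] : Ring.HasFiniteQuotients F[X] where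
  finiteQuotient {I} hI := by
    obtain ⟨f, rfl⟩ := (IsPrincipalIdealRing.principal I).principal
    have hf : f ≠ 0 := fun h => hI (by rw [h, Submodule.span_zero_singleton])
    have : Module.Finite F (AdjoinRoot f) := (AdjoinRoot.powerBasis hf).finite
    exact Module.finite_of_finite F (M := AdjoinRoot f)

theorem card_quotient_span_singleton {f : F[X]} (hf : f ≠ 0) :
    Nat.card (F[X] ⧸ Ideal.span {f}) = Nat.card F ^ f.natDegree := by
  have : Module.Finite F (AdjoinRoot f) := (AdjoinRoot.powerBasis hf).finite
  rw [← finrank_quotient_span_eq_natDegree]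
  exact Module.natCard_eq_pow_finrank (K := F) (V := AdjoinRoot f)

variable [Finite F]

theorem card_le_of_natDegree_eq {s : Finset F[X]} {d : ℕ} (hs : ∀ f ∈ s, f.natDegree = d) :
    s.card ≤ Nat.card F ^ (d + 1) := by
  have hmem (f : s) : f.1 ∈ degreeLT F (d + 1) :=
    mem_degreeLT.mpr <| degree_le_natDegree.trans_lt <| by
      rw [hs f f.2]
      exact_mod_cast d.lt_succ_self
  have hinj : Function.Injective fun f : s => degreeLTEquiv F (d + 1) ⟨f, hmem f⟩ :=
    fun f g h => Subtype.ext (congrArg (fun x : degreeLT F (d + 1) => (x : F[X]))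
      ((degreeLTEquiv F (d + 1)).injective h))
  calc s.card = Nat.card s := (Nat.card_eq_finsetCard s).symm
    _ ≤ Nat.card (Fin (d + 1) → F) := Nat.card_le_card_of_injective _ hinj
    _ = Nat.card F ^ (d + 1) := by rw [Nat.card_fun, Nat.card_fin]

theorem summable_pow_succ_mul_pow_rpow {q : ℕ} (hq : 1 < q) {σ : ℝ} (hσ : 1 < σ) :
    Summable fun d : ℕ => ((q ^ (d + 1) : ℕ) : ℝ) * ((q : ℝ) ^ d) ^ (-σ) := by
  have hq0 : (0 : ℝ) < q := mod_cast one_pos.trans hq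
  have hterm (d : ℕ) : ((q ^ (d + 1) : ℕ) : ℝ) * ((q : ℝ) ^ d) ^ (-σ)
      = q * ((q : ℝ) ^ (1 - σ)) ^ d := by
    rw [Nat.cast_pow, pow_succ', mul_assoc, sub_eq_add_neg, Real.rpow_add hq0, Real.rpow_one,
      mul_pow, Real.rpow_pow_comm hq0.le]
  simp_rw [hterm]
  refine (summable_geometric_of_lt_one (by positivity) ?_).mul_left _
  exact Real.rpow_lt_one_of_one_lt_of_neg (mod_cast hq) (sub_neg.mpr hσ)

theorem summable_card_quotient_polynomial {σ : ℝ} (hσ : 1 < σ) :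
    Summable fun v : HeightOneSpectrum F[X] => (Nat.card (F[X] ⧸ v.asIdeal) : ℝ) ^ (-σ) := by
  classical
  let gen (v : HeightOneSpectrum F[X]) : F[X] := Submodule.IsPrincipal.generator v.asIdeal
  have hspan (v) : Ideal.span {gen v} = v.asIdeal := Ideal.span_singleton_generator _
  have hgen : Function.Injective gen := fun v w h => by
    ext1
    rw [← hspan, ← hspan, h]
  refine summable_of_card_fiber_le (fun v => (gen v).natDegree)
    (h := fun d => ((Nat.card F : ℝ) ^ d) ^ (-σ)) (fun d s hs => ?_)
    (fun _ => by positivity) (fun _ => by positivity) (fun v => ?_)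
    (summable_pow_succ_mul_pow_rpow Finite.one_lt_card hσ)
  · rw [← Finset.card_image_of_injective s hgen]
    exact card_le_of_natDegree_eq (Finset.forall_mem_image.mpr hs)
  · have hgen0 : gen v ≠ 0 := mt (Submodule.IsPrincipal.eq_bot_iff_generator_eq_zero _).mpr v.ne_bot
    rw [← hspan v, card_quotient_span_singleton hgen0, Nat.cast_pow]

end Bases

section RingEquiv

open IsDedekindDomain

variable {R S : Type*} [CommRing R] [CommRing S]

theorem hasFiniteQuotients_of_ringEquiv [Ring.HasFiniteQuotients R] (e : R ≃+* S) :
    Ring.HasFiniteQuotients S where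
  finiteQuotient {I} hI := by
    have hI' : I.map (e.symm : S →+* R) ≠ ⊥ :=
      (Ideal.map_eq_bot_iff_of_injective e.symm.injective).not.mpr hI
    have := Ring.HasFiniteQuotients.finiteQuotient hI'
    exact Finite.of_equiv _ (Ideal.quotientEquiv I _ e.symm rfl).symm.toEquiv

theorem summable_card_quotient_of_ringEquiv (e : R ≃+* S) {σ : ℝ}
    (hs : Summable fun v : HeightOneSpectrum R => (Nat.card (R ⧸ v.asIdeal) : ℝ) ^ (-σ)) :
    Summable fun v : HeightOneSpectrum S => (Nat.card (S ⧸ v.asIdeal) : ℝ) ^ (-σ) := by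
  refine (HeightOneSpectrum.equivOfRingEquiv e).summable_iff.mp (hs.congr fun v => ?_)
  rw [Function.comp_apply, Nat.card_congr (Ideal.quotientEquiv v.asIdeal
    (HeightOneSpectrum.equivOfRingEquiv e v).asIdeal e (Ideal.map_comap_of_equiv e).symm).toEquiv]

end RingEquiv

section GlobalField

open Polynomial IntermediateField Cardinal
open scoped IntermediateField.algebraAdjoinAdjoin

theorem isAlgebraic_and_rank_lt_aleph0 (R E : Type*) [CommRing R] [IsDomain R] [Field E]
    [Algebra R K] [Algebra R E] [Algebra E K] [IsScalarTower R E K] [IsFractionRing R E]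
    [FiniteDimensional E K] : Algebra.IsAlgebraic R K ∧ Module.rank R K < ℵ₀ := by
  refine ⟨(IsFractionRing.comap_isAlgebraic_iff (K := E)).mpr inferInstance, ?_⟩
  rw [← IsFractionRing.rank_right_eq R E K]
  exact Module.rank_lt_aleph0 E K

theorem finite_residueField_and_summable_of_numberField [NumberField K] :
    (∀ P : ClosedPoint K, Finite (ResidueField P.1)) ∧
      ∀ σ > (1 : ℝ), Summable fun P : ClosedPoint K => (pointNorm P : ℝ) ^ (-σ) := by
  obtain ⟨_, hrank⟩ := isAlgebraic_and_rank_lt_aleph0 (K := K) ℤ ℚ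
  have hmem (P : ClosedPoint K) (n : ℤ) : algebraMap ℤ K n ∈ P.1 := intCast_mem P.1 n
  refine ⟨fun P => PointOver.finite_residueField hrank ⟨P, hmem P⟩, fun σ hσ => ?_⟩
  exact (Equiv.subtypeUnivEquiv hmem).symm.summable_iff.mpr
    (PointOver.summable_pointNorm_rpow hrank (zero_le_one.trans hσ.le)
      (summable_card_quotient_int hσ))

variable {F : Subfield K} [Finite F] {u : K}

theorem algebraMap_adjoin_mem {P : ClosedPoint K} (hu : u ∈ P.1) (r : Algebra.adjoin F {u}) :
    algebraMap (Algebra.adjoin F {u}) K r ∈ P.1 := by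
  refine Algebra.adjoin_induction (p := fun x _ => x ∈ P.1) ?_ ?_ ?_ ?_ r.2
  · rintro x rfl
    exact hu
  · exact fun c => subfield_le_valuationSubring F P.1 c.2
  · exact fun x y _ _ => add_mem
  · exact fun x y _ _ => mul_mem

theorem finite_residueField_and_summable_of_transcendental (hu : Transcendental F u)
    [FiniteDimensional F⟮u⟯ K] :
    (∀ P : ClosedPoint K, u ∈ P.1 → Finite (ResidueField P.1)) ∧
      ∀ σ > (1 : ℝ),
        Summable fun P : {P : ClosedPoint K // u ∈ P.1} => (pointNorm P.1 : ℝ) ^ (-σ) := by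
  let e : F[X] ≃+* Algebra.adjoin F {u} := (Polynomial.algEquivOfTranscendental F u hu).toRingEquiv
  have : IsPrincipalIdealRing (Algebra.adjoin F {u}) :=
    IsPrincipalIdealRing.of_surjective e.toRingHom e.surjective
  have := hasFiniteQuotients_of_ringEquiv e
  obtain ⟨_, hrank⟩ := isAlgebraic_and_rank_lt_aleph0 (K := K) (Algebra.adjoin F {u}) F⟮u⟯
  let overAdjoin (P : {P : ClosedPoint K // u ∈ P.1}) : PointOver (Algebra.adjoin F {u}) K :=
    ⟨P.1, algebraMap_adjoin_mem P.2⟩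
  have hinj : Function.Injective overAdjoin := fun P Q h =>
    Subtype.ext (congrArg (fun P' : PointOver (Algebra.adjoin F {u}) K => P'.1) h)
  refine ⟨fun P hP => PointOver.finite_residueField hrank (overAdjoin ⟨P, hP⟩), fun σ hσ => ?_⟩
  have hs := summable_card_quotient_of_ringEquiv e (summable_card_quotient_polynomial hσ)
  have hsum := PointOver.summable_pointNorm_rpow hrank (zero_le_one.trans hσ.le) hs
  exact (hsum.comp_injective hinj :)

theorem finite_residueField_and_summable_pointNorm (hK : IsGlobalField K) :
    (∀ P : ClosedPoint K, Finite (ResidueField P.1)) ∧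
      ∀ σ > (1 : ℝ), Summable fun P : ClosedPoint K => (pointNorm P : ℝ) ^ (-σ) := by
  rcases hK with _ | ⟨F, _, t, ht, _⟩
  · exact finite_residueField_and_summable_of_numberField
  have hadj : F⟮t⁻¹⟯ = F⟮t⟯ := by
    apply le_antisymm <;> rw [adjoin_simple_le_iff]
    · exact inv_mem (mem_adjoin_simple_self F t)
    · simpa using inv_mem (mem_adjoin_simple_self F t⁻¹)
  have : FiniteDimensional F⟮t⁻¹⟯ K := hadj ▸ inferInstance
  have ht' : Transcendental F t⁻¹ := fun h => ht (by simpa using h.inv)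
  obtain ⟨hfin, hsum⟩ := finite_residueField_and_summable_of_transcendental ht
  obtain ⟨hfin', hsum'⟩ := finite_residueField_and_summable_of_transcendental ht'
  refine ⟨fun P => (P.1.mem_or_inv_mem t).elim (hfin P) (hfin' P), fun σ hσ => ?_⟩
  let away (P : ↥{P : ClosedPoint K | t ∈ P.1}ᶜ) : {P : ClosedPoint K // t⁻¹ ∈ P.1} :=
    ⟨P.1, (P.1.1.mem_or_inv_mem t).resolve_left P.2⟩
  have hinj : Function.Injective away := fun P Q h =>
    Subtype.ext (congrArg (fun P' : {P : ClosedPoint K // t⁻¹ ∈ P.1} => P'.1) h)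
  exact Summable.add_compl (s := {P | t ∈ P.1}) (hsum σ hσ) ((hsum' σ hσ).comp_injective hinj :)

theorem two_le_pointNorm (hK : IsGlobalField K) (P : ClosedPoint K) : 2 ≤ pointNorm P := by
  have := (finite_residueField_and_summable_pointNorm hK).1 P
  rw [pointNorm_eq_card_residueField]
  exact Finite.one_lt_card

theorem summable_pointNorm_rpow (hK : IsGlobalField K) {σ : ℝ} (hσ : 1 < σ) :
    Summable fun P : ClosedPoint K => (pointNorm P : ℝ) ^ (-σ) :=
  (finite_residueField_and_summable_pointNorm hK).2 σ hσ

end GlobalField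

section EulerProduct

variable {ι : Type*}

theorem sum_finsuppProd {R : Type*} [CommSemiring R] {g : ι → ℕ → R} (g_zero : ∀ i, g i 0 = 1)
    (T : Finset ι) (N : ℕ) :
    ∑ D ∈ T.finsupp fun _ => Finset.range N, D.prod g = ∏ i ∈ T, ∑ k ∈ Finset.range N, g i k := by
  classical
  rw [Finset.prod_sum, Finset.finsupp, Finset.sum_map]
  refine Finset.sum_congr rfl fun p _ => ?_
  change (Finsupp.indicator T p).prod g = _
  rw [Finsupp.prod_of_support_subset _ (Finsupp.support_indicator_subset T p) _ fun i _ => g_zero i,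
    ← Finset.prod_attach]
  exact Finset.prod_congr rfl fun i _ => by rw [Finsupp.indicator_of_mem i.2]

theorem exists_subset_finsupp_range (S : Finset (ι →₀ ℕ)) :
    ∃ (T : Finset ι) (N : ℕ), ∀ T' N', T ⊆ T' → N ≤ N' →
      S ⊆ T'.finsupp fun _ => Finset.range N' := by
  classical
  refine ⟨S.biUnion Finsupp.support, (S.sup fun D => D.support.sup D) + 1,
    fun T' N' hT hN D hD => Finset.mem_finsupp_iff.mpr
      ⟨(Finset.subset_biUnion_of_mem Finsupp.support hD).trans hT, fun i _ => ?_⟩⟩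
  rw [Finset.mem_range]
  refine lt_of_le_of_lt ?_ hN
  by_cases hi : i ∈ D.support
  · exact (Finset.le_sup (f := D) hi).trans
      (Finset.le_sup (f := fun D : ι →₀ ℕ => D.support.sup D) hD)
  · rw [Finsupp.notMem_support_iff.mp hi]
    exact Nat.zero_le _

theorem summable_norm_of_summable_norm_succ {E : Type*} [SeminormedAddGroup E] {g : ι → ℕ → E}
    (h : Summable fun p : ι × ℕ => ‖g p.1 (p.2 + 1)‖) (i : ι) : Summable fun k => ‖g i k‖ :=
  (summable_nat_add_iff 1).mp (h.comp_injective (Prod.mk_right_injective i))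

variable {R : Type*} [NormedCommRing R] [NormOneClass R] {g : ι → ℕ → R}

theorem summable_norm_finsuppProd (g_zero : ∀ i, g i 0 = 1)
    (h : Summable fun p : ι × ℕ => ‖g p.1 (p.2 + 1)‖) :
    Summable fun D : ι →₀ ℕ => ‖D.prod g‖ := by
  have hg := summable_norm_of_summable_norm_succ h
  refine summable_of_sum_le (fun _ => norm_nonneg _)
    (c := Real.exp (∑' i, ∑' k, ‖g i (k + 1)‖)) fun S => ?_
  obtain ⟨T, N, hS⟩ := exists_subset_finsupp_range S
  calc ∑ D ∈ S, ‖D.prod g‖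
      ≤ ∑ D ∈ T.finsupp fun _ => Finset.range N, ‖D.prod g‖ :=
        Finset.sum_le_sum_of_subset_of_nonneg (hS T N subset_rfl le_rfl) fun _ _ _ => norm_nonneg _
    _ ≤ ∑ D ∈ T.finsupp fun _ => Finset.range N, D.prod fun i k => ‖g i k‖ :=
        Finset.sum_le_sum fun _ _ => Finset.norm_prod_le _ _
    _ = ∏ i ∈ T, ∑ k ∈ Finset.range N, ‖g i k‖ :=
        sum_finsuppProd (fun i => by rw [g_zero, norm_one]) T N
    _ ≤ ∏ i ∈ T, Real.exp (∑' k, ‖g i (k + 1)‖) := by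
        refine Finset.prod_le_prod (fun _ _ => Finset.sum_nonneg fun _ _ => norm_nonneg _)
          fun i _ => ((hg i).sum_le_tsum _ fun _ _ => norm_nonneg _).trans ?_
        rw [(hg i).tsum_eq_zero_add, g_zero, norm_one, add_comm]
        exact Real.add_one_le_exp _
    _ = Real.exp (∑ i ∈ T, ∑' k, ‖g i (k + 1)‖) := (Real.exp_sum _ _).symm
    _ ≤ Real.exp (∑' i, ∑' k, ‖g i (k + 1)‖) :=
        Real.exp_le_exp.mpr (h.prod.sum_le_tsum _ fun i _ => tsum_nonneg fun _ => norm_nonneg _)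

theorem hasProd_tsum_finsuppProd [CompleteSpace R] (g_zero : ∀ i, g i 0 = 1)
    (h : Summable fun p : ι × ℕ => ‖g p.1 (p.2 + 1)‖) :
    HasProd (fun i => ∑' k, g i k) (∑' D : ι →₀ ℕ, D.prod g) := by
  classical
  have hsum := (summable_norm_finsuppProd g_zero h).of_norm.hasSum
  rw [HasSum, SummationFilter.unconditional_filter, Metric.tendsto_atTop] at hsum
  rw [HasProd, SummationFilter.unconditional_filter, Metric.tendsto_atTop]
  intro ε hε
  obtain ⟨S, hS⟩ := hsum (ε / 2) (half_pos hε)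
  obtain ⟨T, N, hTN⟩ := exists_subset_finsupp_range S
  refine ⟨T, fun T' hT' => lt_of_le_of_lt ?_ (half_lt_self hε)⟩
  have hlim : Filter.Tendsto (fun N => ∏ i ∈ T', ∑ k ∈ Finset.range N, g i k) Filter.atTop
      (𝓝 (∏ i ∈ T', ∑' k, g i k)) :=
    tendsto_finsetProd _ fun i _ =>
      (summable_norm_of_summable_norm_succ h i).of_norm.hasSum.tendsto_sum_nat
  refine le_of_tendsto (hlim.dist tendsto_const_nhds) ?_
  filter_upwards [Filter.eventually_ge_atTop N] with N' hN'
  rw [← sum_finsuppProd g_zero]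
  exact (hS _ (hTN T' N' hT' hN')).le

theorem tsum_finsuppProd_ne_zero {𝕜 : Type*} [NormedField 𝕜] [CompleteSpace 𝕜] {g : ι → ℕ → 𝕜}
    (g_zero : ∀ i, g i 0 = 1) (h : Summable fun p : ι × ℕ => ‖g p.1 (p.2 + 1)‖)
    (hne : ∀ i, ∑' k, g i k ≠ 0) : ∑' D : ι →₀ ℕ, D.prod g ≠ 0 := by
  have hfactor : ∀ i, ∑' k, g i k = 1 + ∑' k, g i (k + 1) := fun i => by
    rw [(summable_norm_of_summable_norm_succ h i).of_norm.tsum_eq_zero_add, g_zero]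
  rw [← (hasProd_tsum_finsuppProd g_zero h).tprod_eq]
  simp_rw [hfactor] at hne ⊢
  exact tprod_one_add_ne_zero_of_summable hne <| h.prod.of_nonneg_of_le (fun _ => norm_nonneg _)
    fun i => norm_tsum_le_tsum_norm (h.comp_injective (Prod.mk_right_injective i))

/-- The coefficients `1, a, a x, a x², …` of the power series `1 + a T / (1 - x T)`. At a closed
point `P`, the `k`-th power of the prime divisor contributes the `k`-th coefficient, with
`x = N(P)^{-s}`, to `ζ_K` (where `a = x`) and to `T_K` (where `a = (N(P) - 1)^{-s}`). -/
def geomCoeff {A : Type*} [Semiring A] (a x : A) : ℕ → A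
  | 0 => 1
  | k + 1 => a * x ^ k

theorem geomCoeff_zero {A : Type*} [Semiring A] (a x : A) : geomCoeff a x 0 = 1 := rfl

theorem summable_norm_geomCoeff {a x : ι → R} (ha : Summable fun i => ‖a i‖) {r : ℝ} (hr : r < 1)
    (hx : ∀ i, ‖x i‖ ≤ r) :
    Summable fun p : ι × ℕ => ‖geomCoeff (a p.1) (x p.1) (p.2 + 1)‖ := by
  rcases isEmpty_or_nonempty ι with _ | ⟨⟨i₀⟩⟩
  · exact summable_empty
  have hr₀ : 0 ≤ r := (norm_nonneg _).trans (hx i₀)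
  refine (ha.mul_of_nonneg (summable_geometric_of_lt_one hr₀ hr) (fun _ => norm_nonneg _)
    fun _ => pow_nonneg hr₀ _).of_nonneg_of_le (fun _ => norm_nonneg _) fun p => ?_
  calc ‖a p.1 * x p.1 ^ p.2‖ ≤ ‖a p.1‖ * ‖x p.1‖ ^ p.2 :=
        (norm_mul_le _ _).trans (by gcongr; exact norm_pow_le _ _)
    _ ≤ ‖a p.1‖ * r ^ p.2 := by gcongr; exact hx p.1

theorem tsum_geomCoeff {𝕜 : Type*} [NormedField 𝕜] (a : 𝕜) {x : 𝕜} (hx : ‖x‖ < 1) :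
    ∑' k, geomCoeff a x k = (1 - x)⁻¹ * (1 + a - x) := by
  have hx₁ : 1 - x ≠ 0 := sub_ne_zero.mpr fun h => by simp [← h] at hx
  have hgeom : HasSum (fun k => geomCoeff a x (k + 1)) (a * (1 - x)⁻¹) :=
    (hasSum_geometric_of_norm_lt_one hx).mul_left a
  rw [((hasSum_nat_add_iff 1).mp hgeom).tsum_eq, Finset.sum_range_one, geomCoeff]
  field_simp
  ring

theorem tsum_geomCoeff_self {𝕜 : Type*} [NormedField 𝕜] {x : 𝕜} (hx : ‖x‖ < 1) :
    ∑' k, geomCoeff x x k = (1 - x)⁻¹ := by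
  rw [tsum_geomCoeff x hx, add_sub_cancel_right, mul_one]

/-- The multiplicative function `n ↦ n ^ s`, bundled so that it commutes with `Finsupp.prod`. -/
def natCpowHom (s : ℂ) : ℕ →* ℂ where
  toFun n := (n : ℂ) ^ s
  map_one' := by rw [Nat.cast_one, Complex.one_cpow]
  map_mul' m n := by rw [Nat.cast_mul, Complex.natCast_mul_natCast_cpow]

end EulerProduct

section ShiftedPowers

variable {ι : Type*} {y : ι → ℝ} {s : ℂ}

theorem norm_cpow_sub_cpow_add_one_le {a : ℝ} (ha : 0 < a) (hs : 0 < s.re) :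
    ‖(a : ℂ) ^ (-s) - ((a + 1 : ℝ) : ℂ) ^ (-s)‖ ≤ ‖s‖ * a ^ (-(s.re + 1)) := by
  have hderiv : ∀ x ∈ Set.Icc a (a + 1), HasDerivWithinAt (fun x : ℝ => (x : ℂ) ^ (-s))
      (-s * (x : ℂ) ^ (-s - 1)) (Set.Icc a (a + 1)) x := fun x hx => by
    have := ((hasDerivAt_id (x : ℂ)).cpow_const (c := -s)
      (Complex.ofReal_mem_slitPlane.mpr (ha.trans_le hx.1))).comp_ofReal
    simpa only [id_eq, mul_one] using this.hasDerivWithinAt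
  have hbound : ∀ x ∈ Set.Icc a (a + 1),
      ‖-s * (x : ℂ) ^ (-s - 1)‖ ≤ ‖s‖ * a ^ (-(s.re + 1)) := fun x hx => by
    rw [norm_mul, norm_neg, Complex.norm_cpow_eq_rpow_re_of_pos (ha.trans_le hx.1),
      Complex.sub_re, Complex.neg_re, Complex.one_re, ← neg_add']
    gcongr ‖s‖ * ?_
    exact Real.rpow_le_rpow_of_nonpos ha hx.1 (by linarith)
  have h := (convex_Icc a (a + 1)).norm_image_sub_le_of_norm_hasDerivWithin_le hderiv hbound
    (Set.right_mem_Icc.mpr (by linarith)) (Set.left_mem_Icc.mpr (by linarith))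
  simpa only [sub_add_cancel_left, norm_neg, norm_one, mul_one] using h

theorem summable_norm_cpow_sub_cpow_add_one (hy : ∀ i, 0 < y i) (hs : 0 < s.re)
    (hsum : Summable fun i => y i ^ (-(s.re + 1))) :
    Summable fun i => ‖(y i : ℂ) ^ (-s) - ((y i + 1 : ℝ) : ℂ) ^ (-s)‖ :=
  (hsum.mul_left ‖s‖).of_nonneg_of_le (fun _ => norm_nonneg _)
    fun i => norm_cpow_sub_cpow_add_one_le (hy i) hs

theorem differentiable_cpow_sub_cpow_add_one {a : ℝ} (ha : 0 < a) :
    Differentiable ℂ fun s : ℂ => (a : ℂ) ^ (-s) - ((a + 1 : ℝ) : ℂ) ^ (-s) := by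
  have hpow : ∀ {b : ℝ}, 0 < b → Differentiable ℂ fun s : ℂ => (b : ℂ) ^ (-s) := fun hb =>
    differentiable_neg.const_cpow (.inl (Complex.ofReal_ne_zero.mpr hb.ne'))
  exact (hpow ha).sub (hpow (by linarith))

theorem hasProdLocallyUniformlyOn_one_add_cpow_sub_cpow_add_one (hy : ∀ i, 1 ≤ y i)
    (hsum : ∀ σ : ℝ, 1 < σ → Summable fun i => y i ^ (-σ)) :
    HasProdLocallyUniformlyOn
      (fun i (s : ℂ) => 1 + ((y i : ℂ) ^ (-s) - ((y i + 1 : ℝ) : ℂ) ^ (-s)))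
      (fun s => ∏' i, (1 + ((y i : ℂ) ^ (-s) - ((y i + 1 : ℝ) : ℂ) ^ (-s))))
      {s : ℂ | 0 < s.re} := by
  have hy₀ : ∀ i, 0 < y i := fun i => zero_lt_one.trans_le (hy i)
  refine hasProdLocallyUniformlyOn_of_forall_compact
    (isOpen_lt continuous_const Complex.continuous_re) fun C hC hCc => ?_
  obtain ⟨B, hB⟩ := hCc.isBounded.exists_norm_le
  obtain ⟨δ, hδ, hδC⟩ : ∃ δ : ℝ, 0 < δ ∧ ∀ s ∈ C, δ ≤ s.re :=
    hCc.exists_forall_le' Complex.continuous_re.continuousOn hC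
  refine ((hsum (δ + 1) (by linarith)).mul_left B).hasProdUniformlyOn_one_add hCc
    (Filter.Eventually.of_forall fun i s hs => ?_)
    fun i => (differentiable_cpow_sub_cpow_add_one (hy₀ i)).continuous.continuousOn
  calc ‖(y i : ℂ) ^ (-s) - ((y i + 1 : ℝ) : ℂ) ^ (-s)‖
      ≤ ‖s‖ * y i ^ (-(s.re + 1)) := norm_cpow_sub_cpow_add_one_le (hy₀ i) (hC hs)
    _ ≤ B * y i ^ (-(δ + 1)) :=
        mul_le_mul (hB s hs) (Real.rpow_le_rpow_of_exponent_le (hy i) (by linarith [hδC s hs]))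
          (Real.rpow_nonneg (hy₀ i).le _) ((norm_nonneg s).trans (hB s hs))

theorem summable_sub_one_rpow_neg (hy : ∀ i, 2 ≤ y i) {σ : ℝ} (hσ : 0 ≤ σ)
    (hsum : Summable fun i => y i ^ (-σ)) : Summable fun i => (y i - 1) ^ (-σ) := by
  refine (hsum.mul_left ((2 : ℝ) ^ σ)).of_nonneg_of_le
    (fun i => Real.rpow_nonneg (by linarith [hy i]) _) fun i => ?_
  have hi := hy i
  calc (y i - 1) ^ (-σ) ≤ (y i / 2) ^ (-σ) :=
        Real.rpow_le_rpow_of_nonpos (by linarith) (by linarith) (by linarith)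
    _ = 2 ^ σ * y i ^ (-σ) := by
        rw [Real.div_rpow (by linarith) two_pos.le, Real.rpow_neg two_pos.le, div_inv_eq_mul,
          mul_comm]

end ShiftedPowers

section EulerFactor

theorem two_le_cast_pointNorm (hK : IsGlobalField K) (P : ClosedPoint K) :
    (2 : ℝ) ≤ pointNorm P := by
  exact_mod_cast two_le_pointNorm hK P

theorem summable_pointNorm_sub_one_rpow (hK : IsGlobalField K) {σ : ℝ} (hσ : 1 < σ) :
    Summable fun P : ClosedPoint K => ((pointNorm P : ℝ) - 1) ^ (-σ) :=
  summable_sub_one_rpow_neg (two_le_cast_pointNorm hK) (by linarith)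
    (summable_pointNorm_rpow hK hσ)

theorem eulerFactor_eq (P : ClosedPoint K) (s : ℂ) :
    eulerFactor P s = 1 + (((pointNorm P - 1 : ℝ) : ℂ) ^ (-s) -
      ((pointNorm P - 1 + 1 : ℝ) : ℂ) ^ (-s)) := by
  simp only [eulerFactor, sub_add_cancel, Complex.ofReal_sub, Complex.ofReal_natCast,
    Complex.ofReal_one, add_sub_assoc]

theorem summable_norm_eulerFactor_sub_one (hK : IsGlobalField K) {s : ℂ} (hs : 0 < s.re) :
    Summable fun P : ClosedPoint K => ‖eulerFactor P s - 1‖ := by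
  simp_rw [eulerFactor_eq, add_sub_cancel_left]
  exact summable_norm_cpow_sub_cpow_add_one (fun P => by linarith [two_le_cast_pointNorm hK P]) hs
    (summable_pointNorm_sub_one_rpow hK (by linarith))

theorem hasProdLocallyUniformlyOn_eulerFactor (hK : IsGlobalField K) :
    HasProdLocallyUniformlyOn (fun (P : ClosedPoint K) (s : ℂ) => eulerFactor P s) (eulerProd K)
      {s : ℂ | 0 < s.re} := by
  unfold eulerProd
  simp_rw [eulerFactor_eq]
  exact hasProdLocallyUniformlyOn_one_add_cpow_sub_cpow_add_one
    (fun P => by linarith [two_le_cast_pointNorm hK P])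
    fun σ hσ => summable_pointNorm_sub_one_rpow hK hσ

theorem differentiableOn_eulerProd (hK : IsGlobalField K) :
    DifferentiableOn ℂ (eulerProd K) {s : ℂ | 0 < s.re} := by
  refine (hasProdLocallyUniformlyOn_iff_tendstoLocallyUniformlyOn.mp
    (hasProdLocallyUniformlyOn_eulerFactor hK)).differentiableOn
    (Filter.Eventually.of_forall fun S => DifferentiableOn.fun_finsetProd fun P _ => ?_)
    (isOpen_lt continuous_const Complex.continuous_re)
  rw [show eulerFactor P = _ from funext (eulerFactor_eq P)]
  exact ((differentiable_cpow_sub_cpow_add_one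
    (by linarith [two_le_cast_pointNorm hK P])).const_add 1).differentiableOn

end EulerFactor

section DirichletSeries

theorem norm_cpow_eq_prod_geomCoeff (D : EffDivisor K) (s : ℂ) :
    (norm D : ℂ) ^ s =
      D.prod fun P => geomCoeff ((pointNorm P : ℂ) ^ s) ((pointNorm P : ℂ) ^ s) := by
  change natCpowHom s (norm D) = _
  rw [norm_eq_prod_pointNorm, map_finsuppProd]
  refine Finsupp.prod_congr fun P hP => ?_
  obtain ⟨k, hk⟩ := Nat.exists_eq_add_one_of_ne_zero (Finsupp.mem_support_iff.mp hP)
  rw [hk, map_pow, pow_succ']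
  rfl

theorem euler_cpow_eq_prod_geomCoeff (hK : IsGlobalField K) (D : EffDivisor K) (s : ℂ) :
    (euler D : ℂ) ^ s =
      D.prod fun P => geomCoeff (((pointNorm P : ℂ) - 1) ^ s) ((pointNorm P : ℂ) ^ s) := by
  change natCpowHom s (euler D) = _
  rw [euler_eq_prod_pointNorm (finite_residueField_and_summable_pointNorm hK).1, map_finsuppProd]
  refine Finsupp.prod_congr fun P hP => ?_
  obtain ⟨k, hk⟩ := Nat.exists_eq_add_one_of_ne_zero (Finsupp.mem_support_iff.mp hP)
  rw [hk, Nat.add_sub_cancel, map_mul, map_pow, mul_comm, geomCoeff,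
    ← Nat.cast_pred (zero_lt_two.trans_le (two_le_pointNorm hK P))]
  rfl

theorem euler_pos (hK : IsGlobalField K) (D : EffDivisor K) : 0 < euler D := by
  rw [euler_eq_prod_pointNorm (finite_residueField_and_summable_pointNorm hK).1]
  refine Finset.prod_pos fun P _ => ?_
  have := two_le_pointNorm hK P
  exact Nat.mul_pos (Nat.pow_pos (by omega)) (by omega)

variable {s : ℂ}

theorem norm_pointNorm_cpow (hK : IsGlobalField K) (P : ClosedPoint K) (s : ℂ) :
    ‖(pointNorm P : ℂ) ^ (-s)‖ = (pointNorm P : ℝ) ^ (-s.re) :=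
  Complex.norm_natCast_cpow_of_pos (zero_lt_two.trans_le (two_le_pointNorm hK P)) _

theorem norm_pointNorm_cpow_le (hK : IsGlobalField K) (hs : 1 < s.re) (P : ClosedPoint K) :
    ‖(pointNorm P : ℂ) ^ (-s)‖ ≤ 1 / 2 := by
  have hP := two_le_cast_pointNorm hK P
  calc ‖(pointNorm P : ℂ) ^ (-s)‖ = (pointNorm P : ℝ) ^ (-s.re) := norm_pointNorm_cpow hK P s
    _ ≤ (pointNorm P : ℝ) ^ (-1 : ℝ) :=
        Real.rpow_le_rpow_of_exponent_le (by linarith) (by linarith)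
    _ = (pointNorm P : ℝ)⁻¹ := Real.rpow_neg_one _
    _ ≤ 1 / 2 := by rw [one_div]; exact inv_anti₀ two_pos hP

theorem norm_pointNorm_cpow_lt_one (hK : IsGlobalField K) (hs : 1 < s.re) (P : ClosedPoint K) :
    ‖(pointNorm P : ℂ) ^ (-s)‖ < 1 :=
  (norm_pointNorm_cpow_le hK hs P).trans_lt one_half_lt_one

theorem summable_norm_geomCoeff_weilZeta (hK : IsGlobalField K) (hs : 1 < s.re) :
    Summable fun p : ClosedPoint K × ℕ =>
      ‖geomCoeff ((pointNorm p.1 : ℂ) ^ (-s)) ((pointNorm p.1 : ℂ) ^ (-s)) (p.2 + 1)‖ :=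
  summable_norm_geomCoeff
    (a := fun P : ClosedPoint K => (pointNorm P : ℂ) ^ (-s))
    (x := fun P : ClosedPoint K => (pointNorm P : ℂ) ^ (-s))
    ((summable_pointNorm_rpow hK hs).congr fun P => (norm_pointNorm_cpow hK P s).symm)
    one_half_lt_one (norm_pointNorm_cpow_le hK hs)

theorem summable_norm_geomCoeff_totientZeta (hK : IsGlobalField K) (hs : 1 < s.re) :
    Summable fun p : ClosedPoint K × ℕ =>
      ‖geomCoeff (((pointNorm p.1 : ℂ) - 1) ^ (-s)) ((pointNorm p.1 : ℂ) ^ (-s)) (p.2 + 1)‖ := by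
  refine summable_norm_geomCoeff
    (a := fun P : ClosedPoint K => ((pointNorm P : ℂ) - 1) ^ (-s))
    (x := fun P : ClosedPoint K => (pointNorm P : ℂ) ^ (-s))
    ?_ one_half_lt_one (norm_pointNorm_cpow_le hK hs)
  refine (summable_pointNorm_sub_one_rpow hK hs).congr fun P => ?_
  have hP : (0 : ℝ) < pointNorm P - 1 := by linarith [two_le_cast_pointNorm hK P]
  exact_mod_cast (Complex.norm_cpow_eq_rpow_re_of_pos hP (-s)).symm

theorem summable_norm_norm_cpow (hK : IsGlobalField K) (hs : 1 < s.re) :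
    Summable fun D : EffDivisor K => ‖(norm D : ℂ) ^ (-s)‖ := by
  simp_rw [norm_cpow_eq_prod_geomCoeff]
  exact summable_norm_finsuppProd (fun _ => geomCoeff_zero _ _)
    (summable_norm_geomCoeff_weilZeta hK hs)

theorem summable_norm_euler_cpow (hK : IsGlobalField K) (hs : 1 < s.re) :
    Summable fun D : EffDivisor K => ‖(euler D : ℂ) ^ (-s)‖ := by
  simp_rw [euler_cpow_eq_prod_geomCoeff hK]
  exact summable_norm_finsuppProd (fun _ => geomCoeff_zero _ _)
    (summable_norm_geomCoeff_totientZeta hK hs)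

theorem hasProd_weilZeta (hK : IsGlobalField K) (hs : 1 < s.re) :
    HasProd (fun P : ClosedPoint K => (1 - (pointNorm P : ℂ) ^ (-s))⁻¹) (weilZeta K s) := by
  simp_rw [weilZeta, norm_cpow_eq_prod_geomCoeff,
    ← tsum_geomCoeff_self (norm_pointNorm_cpow_lt_one hK hs _)]
  exact hasProd_tsum_finsuppProd (fun _ => geomCoeff_zero _ _)
    (summable_norm_geomCoeff_weilZeta hK hs)

theorem weilZeta_ne_zero (hK : IsGlobalField K) (hs : 1 < s.re) : weilZeta K s ≠ 0 := by
  simp_rw [weilZeta, norm_cpow_eq_prod_geomCoeff]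
  refine tsum_finsuppProd_ne_zero (fun _ => geomCoeff_zero _ _)
    (summable_norm_geomCoeff_weilZeta hK hs) fun P => ?_
  rw [tsum_geomCoeff_self (norm_pointNorm_cpow_lt_one hK hs P)]
  exact inv_ne_zero <| sub_ne_zero.mpr fun h => by
    simpa only [← h, norm_one, lt_irrefl] using norm_pointNorm_cpow_lt_one hK hs P

theorem hasProd_totientZeta (hK : IsGlobalField K) (hs : 1 < s.re) :
    HasProd (fun P : ClosedPoint K => (1 - (pointNorm P : ℂ) ^ (-s))⁻¹ * eulerFactor P s)
      (totientZeta K s) := by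
  simp_rw [totientZeta, euler_cpow_eq_prod_geomCoeff hK, eulerFactor,
    ← tsum_geomCoeff _ (norm_pointNorm_cpow_lt_one hK hs _)]
  exact hasProd_tsum_finsuppProd (fun _ => geomCoeff_zero _ _)
    (summable_norm_geomCoeff_totientZeta hK hs)

theorem totientZeta_eq_mul (hK : IsGlobalField K) (hs : 1 < s.re) :
    totientZeta K s = weilZeta K s * eulerProd K s :=
  (hasProd_totientZeta hK hs).unique <| (hasProd_weilZeta hK hs).mul <|
    (hasProdLocallyUniformlyOn_eulerFactor hK).hasProd (x := s) (zero_lt_one.trans hs)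

theorem tendstoUniformlyOn_totientZeta (hK : IsGlobalField K) {δ : ℝ} (hδ : 0 < δ) :
    TendstoUniformlyOn
      (fun (S : Finset (EffDivisor K)) (s : ℂ) => ∑ D ∈ S, (euler D : ℂ) ^ (-s))
      (totientZeta K) Filter.atTop {s : ℂ | 1 + δ ≤ s.re} := by
  have hsum := summable_norm_euler_cpow hK (s := ((1 + δ : ℝ) : ℂ))
    (by rw [Complex.ofReal_re]; linarith)
  refine tendstoUniformlyOn_tsum hsum fun D s hs => ?_
  have hpos := euler_pos hK D
  rw [Complex.norm_natCast_cpow_of_pos hpos, Complex.norm_natCast_cpow_of_pos hpos,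
    Complex.neg_re, Complex.neg_re, Complex.ofReal_re]
  exact Real.rpow_le_rpow_of_exponent_le (Nat.one_le_cast.mpr hpos) (neg_le_neg hs)

end DirichletSeries

end GlobalTotient

end

theorem theoremC (K : Type*) [Field K] (hK : GlobalTotient.IsGlobalField K) :
    -- absolute convergence of the series `T_K(s)` for `Re s > 1`
    (∀ s : ℂ, 1 < s.re →
      Summable fun D : GlobalTotient.EffDivisor K => ‖(GlobalTotient.euler D : ℂ) ^ (-s)‖) ∧
    -- uniform convergence on every half plane `Re s ≥ 1 + δ`
    (∀ δ : ℝ, 0 < δ →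
      TendstoUniformlyOn
        (fun (S : Finset (GlobalTotient.EffDivisor K)) (s : ℂ) =>
          ∑ D ∈ S, (GlobalTotient.euler D : ℂ) ^ (-s))
        (GlobalTotient.totientZeta K) Filter.atTop {s : ℂ | 1 + δ ≤ s.re}) ∧
    -- the identity, with a convergent nonvanishing zeta function, for `Re s > 1`
    (∀ s : ℂ, 1 < s.re →
      (Summable fun D : GlobalTotient.EffDivisor K => ‖(GlobalTotient.norm D : ℂ) ^ (-s)‖) ∧
      GlobalTotient.weilZeta K s ≠ 0 ∧
      GlobalTotient.totientZeta K s =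
        GlobalTotient.weilZeta K s * GlobalTotient.eulerProd K s ∧
      GlobalTotient.totientZeta K s / GlobalTotient.weilZeta K s =
        GlobalTotient.eulerProd K s) ∧
    -- the product converges absolutely and locally uniformly to a holomorphic function
    -- for `Re s > 0`
    (∀ s : ℂ, 0 < s.re →
      Summable fun P : GlobalTotient.ClosedPoint K => ‖GlobalTotient.eulerFactor P s - 1‖) ∧
    HasProdLocallyUniformlyOn
      (fun (P : GlobalTotient.ClosedPoint K) (s : ℂ) => GlobalTotient.eulerFactor P s)
      (GlobalTotient.eulerProd K) {s : ℂ | 0 < s.re} ∧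
    DifferentiableOn ℂ (GlobalTotient.eulerProd K) {s : ℂ | 0 < s.re} := by
  refine ⟨fun s hs => GlobalTotient.summable_norm_euler_cpow hK hs,
    fun δ hδ => GlobalTotient.tendstoUniformlyOn_totientZeta hK hδ, fun s hs => ?_,
    fun s hs => GlobalTotient.summable_norm_eulerFactor_sub_one hK hs,
    GlobalTotient.hasProdLocallyUniformlyOn_eulerFactor hK,
    GlobalTotient.differentiableOn_eulerProd hK⟩
  have hζ := GlobalTotient.weilZeta_ne_zero hK hs
  have hT := GlobalTotient.totientZeta_eq_mul hK hs
  exact ⟨GlobalTotient.summable_norm_norm_cpow hK hs, hζ, hT,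
    by rw [hT, mul_div_cancel_left₀ _ hζ]⟩
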